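/- Lemma 1. Consider a game with $N$ players with local action sets $A_i\subset\mathbb R^{d_i}$, cost functions $J_i:\mathbb R^{D}\to\mathbb R$ of the joint action $a=[a^1,\dots,a^N]$, $D=d_1+\dots+d_N$, and a coupling constraint $g(a)\le 0$ with $g:\mathbb R^{D}\to\mathbb R^n$. Put $A=A_1\times\dots\times A_N$ and $Q=\{a\in A: g(a)\le 0\}$. Assume the following. (Convexity) Each $A_i$ is convex and compact; each $J_i$ is continuously differentiable on $\mathbb R^{D}$ and convex in $a^i\in\mathbb R^{d_i}$ for every fixed $a^{-i}$; $g$ is continuously differentiable with convex coordinates. (Slater's condition) Each $A_i$ is described by finitely many inequalities $h_{ij}(a^i)\le 0$ with convex functions $h_{ij}:\mathbb R^{d_i}\to\mathbb R$, and there is a joint action $\bar a$ with $h_{ij}(\bar a^i)<0$ for all $i,j$ and $g_k(\bar a)<0$ for all $k$. Let the associated uncoupled game have $N+1$ players: the regular players $i=1,\dots,N$ with action sets $A_i$ and costs $J_i(a)+(\lambda,g(a))$, and a dual player with action set $\mathbb R^n_+$, action $\lambda$ and cost $-(\lambda,g(a))$. Let $M^0(a,\lambda)\in\mathbb R^{D+n}$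 be the vector whose components are $\partial J_i(a)/\partial a^i_k+\partial(\lambda,g(a))/\partial a^i_k$ ($1\le i\le N$, $1\le k\le d_i$), followed by the block $-g(a)$. The solutions of $VI(Y,T)$ are the $y^*\in Y$ with $(T(y^*),y-y^*)\ge 0$ for all $y\in Y$. A generalized Nash equilibrium of the original game is a point $a^*\in Q$ such that, for every $i$, $J_i(a^*)\le J_i(a^i,a^{*-i})$ for all $a^i\in A_i$ with $g(a^i,a^{*-i})\le 0$. Then: 1) $[a^*,\lambda^*]$ is a Nash equilibrium of the associated game if and only if it solves $VI(A\times\mathbb R^n_+,M^0)$; 2) if $[a^*,\lambda^*]$ is a Nash equilibrium of the associated game, then $a^*$ is a generalized Nash equilibrium of the original game; 3) the associated game has a Nash equilibrium; 4) there is a constant $K>0$ such that $\|\lambda^*\|\le K$ for every Nash equilibrium $[a^*,\lambda^*]$ of the associated game. -/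

import Mathlib

/-- The action space `ℝ^m` of a single player, with the Euclidean inner product. -/
abbrev ActionSpace (m : ℕ) : Type := EuclideanSpace ℝ (Fin m)

/-- The space of joint actions `[a¹, …, aᴺ]` with the Euclidean inner product; the dimension
`d i` of the actions may depend on the player `i`. -/
abbrev JointSpace {N : ℕ} (d : Fin N → ℕ) : Type := PiLp 2 (fun i => ActionSpace (d i))

/-- The space of pairs `[a, l]` of a joint action and a dual variable `l ∈ ℝⁿ`, with the
Euclidean inner product. -/
abbrev ExtSpace {N : ℕ} (d : Fin N → ℕ) (n : ℕ) : Type :=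
  WithLp 2 (JointSpace d × ActionSpace n)

/-- The joint action `(x, a^{-i})` in which player `i` plays `x` and the others play as in `a`. -/
def deviate {N : ℕ} {d : Fin N → ℕ} (a : JointSpace d) (i : Fin N) (x : ActionSpace (d i)) :
    JointSpace d :=
  WithLp.toLp 2 (Function.update a.ofLp i x)

/-- The partial derivative `∂F(a)/∂a^i_k`. -/
noncomputable def partialD {N : ℕ} {d : Fin N → ℕ} (F : JointSpace d → ℝ) (a : JointSpace d)
    (i : Fin N) (k : Fin (d i)) : ℝ :=
  lineDeriv ℝ F a (PiLp.single 2 i (EuclideanSpace.single k (1 : ℝ)))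

/-- The nonnegative orthant `ℝⁿ₊`. -/
def nonnegOrthant (n : ℕ) : Set (ActionSpace n) := {l | ∀ k, 0 ≤ l k}

/-- The solution set of the variational inequality `VI(Y, T)`. -/
def SOL {H : Type*} [NormedAddCommGroup H] [InnerProductSpace ℝ H] (Y : Set H) (T : H → H) :
    Set H :=
  {y | y ∈ Y ∧ ∀ z ∈ Y, 0 ≤ inner ℝ (T y) (z - y)}

/-- Nash equilibria of a game with uncoupled action sets `S i` and cost functions `cost i`. -/
def IsNashEquilibrium {ι : Type*} [DecidableEq ι] {X : ι → Type*} (S : ∀ i, Set (X i))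
    (cost : ι → (∀ i, X i) → ℝ) (x : ∀ i, X i) : Prop :=
  (∀ i, x i ∈ S i) ∧ ∀ i, ∀ y ∈ S i, cost i x ≤ cost i (Function.update x i y)

/-- The data of a game with `N` players, local action sets `A i`, cost functions `J i` and
coupling constraint `g a ≤ 0` with `n` coordinates. -/
structure Game (N n : ℕ) (d : Fin N → ℕ) where
  /-- local action sets -/
  A : ∀ i, Set (ActionSpace (d i))
  /-- cost functions -/
  J : Fin N → JointSpace d → ℝ
  /-- coupling constraint function -/
  g : JointSpace d → ActionSpace n

namespace Game

variable {N n : ℕ} {d : Fin N → ℕ}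

/-- The product `A = A₁ × … × A_N`. -/
def jointA (G : Game N n d) : Set (JointSpace d) := {a | ∀ i, a i ∈ G.A i}

/-- The coupling constraint set `C = {a ∈ A : g(a) ≤ 0}`. -/
def C (G : Game N n d) : Set (JointSpace d) := {a | a ∈ G.jointA ∧ ∀ k, G.g a k ≤ 0}

/-- The set `Q = A ∩ C` of feasible joint actions. -/
def Q (G : Game N n d) : Set (JointSpace d) := G.jointA ∩ G.C

/-- The set `Qⁱ(a^{-i})` of actions of player `i` that are feasible against `a^{-i}`. -/
def Qi (G : Game N n d) (i : Fin N) (a : JointSpace d) : Set (ActionSpace (d i)) :=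
  {x | x ∈ G.A i ∧ ∀ k, G.g (deviate a i x) k ≤ 0}

/-- Generalized Nash equilibria. -/
def IsGNE (G : Game N n d) (a : JointSpace d) : Prop :=
  a ∈ G.Q ∧ ∀ i, ∀ x ∈ G.Qi i a, G.J i a ≤ G.J i (deviate a i x)

/-- The game is convex. -/
structure IsConvex (G : Game N n d) : Prop where
  convex_A : ∀ i, Convex ℝ (G.A i)
  compact_A : ∀ i, IsCompact (G.A i)
  contDiff_J : ∀ i, ContDiff ℝ 1 (G.J i)
  convex_J : ∀ i a, ConvexOn ℝ Set.univ (fun x => G.J i (deviate a i x))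
  contDiff_g : ContDiff ℝ 1 G.g
  convex_g : ∀ k, ConvexOn ℝ Set.univ (fun a => G.g a k)

/-- Slater's constraint qualification. Every `A i` is described by finitely many convex
inequalities `h i j ≤ 0`; these and `g ≤ 0` describe `Q`, and some joint action satisfies all of
them strictly. (The same point witnesses the qualification for `A` and for every `A i`.) -/
def Slater (G : Game N n d) : Prop :=
  ∃ (m : Fin N → ℕ) (h : ∀ i, Fin (m i) → ActionSpace (d i) → ℝ),
    (∀ i j, ConvexOn ℝ Set.univ (h i j)) ∧
    (∀ i, G.A i = {x | ∀ j, h i j x ≤ 0}) ∧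
    ∃ a : JointSpace d, (∀ i j, h i j (a i) < 0) ∧ ∀ k, G.g a k < 0

/-- The game mapping `M`, with `M_{i,k}(a) = ∂J_i(a)/∂a^i_k`. -/
noncomputable def M (G : Game N n d) (a : JointSpace d) : JointSpace d :=
  WithLp.toLp 2 fun i => WithLp.toLp 2 fun k => partialD (G.J i) a i k

/-- The extended game mapping `M⁰`: its component `(i,k)` is
`M_{i,k}(a) + ∂(l, g(a))/∂a^i_k`, and its last block is `-g(a)`. -/
noncomputable def M0 (G : Game N n d) (η : ExtSpace d n) : ExtSpace d n :=
  WithLp.toLp 2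
    (WithLp.toLp 2 fun i => WithLp.toLp 2 fun k =>
        G.M η.fst i k + partialD (fun a => inner ℝ η.snd (G.g a)) η.fst i k,
      -G.g η.fst)

/-- The set `A × ℝⁿ₊`. -/
def extSet (G : Game N n d) : Set (ExtSpace d n) :=
  {η | η.fst ∈ G.jointA ∧ η.snd ∈ nonnegOrthant n}

/-! The associated game has the `N` regular players `some i` and one dual player `none`. -/

/-- The spaces of actions in the associated game. -/
abbrev AssocSpace (n : ℕ) (d : Fin N → ℕ) : Option (Fin N) → Type
  | some i => ActionSpace (d i)
  | none => ActionSpace n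

/-- The action sets of the associated game: `A i` for the regular players and `ℝⁿ₊` for the
dual player. -/
def assocSet (G : Game N n d) : ∀ p, Set (AssocSpace n d p)
  | some i => G.A i
  | none => nonnegOrthant n

/-- The joint action of the regular players in a profile of the associated game. -/
def regularPart (x : ∀ p, AssocSpace n d p) : JointSpace d := WithLp.toLp 2 fun i => x (some i)

/-- The cost functions of the associated game: `J_i(a) + (l, g(a))` for the regular players and
`-(l, g(a))` for the dual player. -/
noncomputable def assocCost (G : Game N n d) : Option (Fin N) → (∀ p, AssocSpace n d p) → ℝ
  | some i, x => G.J i (regularPart x) + inner ℝ (x none) (G.g (regularPart x))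
  | none, x => -inner ℝ (x none) (G.g (regularPart x))

/-- The pair `[a, l]` as a profile of the associated game. -/
def assocProfile (a : JointSpace d) (l : ActionSpace n) : ∀ p, AssocSpace n d p
  | some i => a i
  | none => l

/-- `[a, l]` is a Nash equilibrium of the associated game. -/
def IsAssocNash (G : Game N n d) (a : JointSpace d) (l : ActionSpace n) : Prop :=
  IsNashEquilibrium G.assocSet G.assocCost (assocProfile a l)

end Game

/-! For fixed `l ≥ 0` each regular cost is differentiable and convex in the player's own action, so
being a best response is the same as a first-order inequality. The dual cost is linear. Summing
these conditions gives the variational inequality of `M0`; varying one block at a time recovers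
them, which is 1). The optimality of the dual player forces `g(a) ≤ 0` and `(l, g(a)) = 0`. On
deviations feasible for the original game the term `(l, g)` is nonpositive, hence 2).

For 4), test the regular conditions at a Slater point `b`. Every player faces the same `(l, g)`, so
the constraint terms add up to one full derivative, and convexity bounds it by `(l, g(b)) - (l,
g(a))`. This is at most `-ε ∑ l_k` once `(l, g(a)) ≥ 0`, while the terms from `J` are bounded on the
compact `A`.

For 3), the orthant is not compact, so it is truncated to a box. `SOL_nonempty` gives a solution
there, and the bound of 4), which compares `l` only with the dual action `0`, applies to it as well.
In a larger box the upper faces are therefore inactive and the truncated solution is an equilibrium.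
`SOL_nonempty` rests on Brouwer's theorem, proved here by the Milnor–Rogers volume argument. -/

/-! ### Metric projection onto a convex set. -/

theorem exists_lipschitz_convex_projection {E : Type*} [NormedAddCommGroup E]
    [InnerProductSpace ℝ E] {K : Set E} (hne : K.Nonempty) (hcomp : IsComplete K)
    (hconv : Convex ℝ K) :
    ∃ p : E → E, LipschitzWith 1 p ∧ (∀ x, p x ∈ K) ∧
      (∀ x, ∀ z ∈ K, inner ℝ (x - p x) (z - p x) ≤ 0) ∧ ∀ x ∈ K, p x = x := by
  choose p hpK hp using exists_norm_eq_iInf_of_complete_convex hne hcomp hconv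
  have hin : ∀ x, ∀ z ∈ K, inner ℝ (x - p x) (z - p x) ≤ 0 := fun x =>
    (norm_eq_iInf_iff_real_inner_le_zero hconv (hpK x)).1 (hp x)
  refine ⟨p, LipschitzWith.of_dist_le_mul fun x y => ?_, hpK, hin, fun x hx => ?_⟩
  · rw [dist_eq_norm, dist_eq_norm, NNReal.coe_one, one_mul]
    have h1 := hin x (p y) (hpK y)
    have h2 := hin y (p x) (hpK x)
    -- The sum of the two obtuse-angle inequalities; Cauchy–Schwarz then gives the Lipschitz bound.
    have h3 : ‖p x - p y‖ * ‖p x - p y‖ ≤ inner ℝ (x - y) (p x - p y) := by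
      rw [← real_inner_self_eq_norm_mul_norm]
      have e1 : p y - p x = -(p x - p y) := by abel
      rw [e1, inner_neg_right] at h1
      have e2 : x - y = (x - p x) - (y - p y) + (p x - p y) := by abel
      rw [e2, inner_add_left, inner_sub_left (x - p x)]
      linarith
    have h4 := h3.trans (real_inner_le_norm _ _)
    rcases (norm_nonneg (p x - p y)).eq_or_lt with h | h
    · rw [← h]; exact norm_nonneg _
    · exact le_of_mul_le_mul_right h4 h
  · have h := hin x x hx
    rw [real_inner_self_eq_norm_mul_norm] at h
    have : ‖x - p x‖ = 0 := by nlinarith [norm_nonneg (x - p x)]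
    exact (sub_eq_zero.1 (norm_eq_zero.1 this)).symm

/-! ### Brouwer's theorem and variational inequalities on compact convex sets. -/

section Brouwer

open MeasureTheory Metric Set

variable {E : Type*} [NormedAddCommGroup E] [InnerProductSpace ℝ E] [FiniteDimensional ℝ E]

/-- By the Neumann series `1 + sA` is invertible for `s ∈ [0, 1]`, so its determinant cannot change
sign on the way from `s = 0`, where it is `1`. -/
theorem ContinuousLinearMap.det_one_add_pos {A : E →L[ℝ] E} (hA : ‖A‖ < 1) :
    0 < (1 + A).det := by
  have hne : ∀ s ∈ Icc (0 : ℝ) 1, (1 + s • A).det ≠ 0 := fun s hs => by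
    have hlt : ‖-(s • A)‖ < 1 := by
      rw [norm_neg, norm_smul, Real.norm_of_nonneg hs.1]
      nlinarith [hs.1, hs.2, norm_nonneg A]
    have hu : IsUnit (1 + s • A) := by
      simpa using (Units.oneSub _ hlt).isUnit
    have : IsUnit ((1 + s • A : E →L[ℝ] E) : E →ₗ[ℝ] E) :=
      hu.map (ContinuousLinearMap.toLinearMapRingHom (R₁ := ℝ) (M₁ := E))
    exact (this.map (LinearMap.det : (E →ₗ[ℝ] E) →* ℝ)).ne_zero
  have hcont : Continuous fun s : ℝ => (1 + s • A).det :=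
    ContinuousLinearMap.continuous_det.comp (by fun_prop)
  by_contra hneg
  have h0 : (1 + (0 : ℝ) • A).det = 1 := by
    rw [zero_smul, add_zero]
    exact LinearMap.det_id
  have h1 : (1 + (1 : ℝ) • A).det ≤ 0 := by simpa using hneg
  obtain ⟨s, hs, hs0⟩ := intermediate_value_Icc' (zero_le_one' ℝ) hcont.continuousOn
    (show (0 : ℝ) ∈ Icc _ _ from ⟨h1, by rw [h0]; exact zero_le_one⟩)
  exact hne s hs hs0

variable (E) in
/-- The polynomial `t ↦ det (1 + t A)` is determined at `t = 1` by its values at small `t`,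
linearly and with coefficients that do not depend on `A`. -/
theorem ContinuousLinearMap.exists_det_one_add_eq_sum {δ : ℝ} (hδ : 0 < δ) :
    ∃ (s : Finset ℝ) (c : ℝ → ℝ), (∀ t ∈ s, t ∈ Ioo 0 δ) ∧
      ∀ A : E →L[ℝ] E, (1 + A).det = ∑ t ∈ s, c t * (1 + t • A).det := by
  -- The polynomial has degree at most `finrank ℝ E`, so one more node than that determines it by
  -- Lagrange interpolation.
  obtain ⟨s, hs, hcard⟩ := (Ioo_infinite hδ).exists_subset_card_eq (Module.finrank ℝ E + 1)
  refine ⟨s, fun t => (Lagrange.basis s id t).eval 1, fun t ht => hs ht, fun A => ?_⟩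
  let b := Module.finBasis ℝ E
  let M := LinearMap.toMatrix b b (A : E →ₗ[ℝ] E)
  let q : Polynomial ℝ :=
    ((Polynomial.X : Polynomial ℝ) • M.map Polynomial.C +
      (1 : Matrix _ _ ℝ).map Polynomial.C).det
  have hq : ∀ t : ℝ, q.eval t = (1 + t • A).det := fun t => by
    have : (1 + t • A).det = (1 + t • M).det := by
      rw [ContinuousLinearMap.det, ← LinearMap.det_toMatrix b]
      congr 1
      simp [M, LinearMap.toMatrix_one]
    rw [this]
    simp only [q]
    rw [← Polynomial.coe_evalRingHom, RingHom.map_det]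
    congr 1
    ext i j
    by_cases hij : i = j <;> simp [hij, add_comm, mul_comm t]
  have hdeg : q.degree < s.card := by
    rw [hcard]
    refine Polynomial.degree_le_natDegree.trans_lt ?_
    have := Polynomial.natDegree_det_X_add_C_le M 1
    rw [Fintype.card_fin] at this
    exact_mod_cast Nat.lt_succ_of_le this
  have h := Lagrange.eq_interpolate (s := s) (v := id) (injOn_id _) hdeg
  rw [show (1 + A).det = q.eval 1 by rw [hq, one_smul], h, Lagrange.interpolate_apply,
    Polynomial.eval_finsetSum]
  refine Finset.sum_congr rfl fun t ht => ?_
  simp [hq, mul_comm]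

/-- A `C¹` map on the closed unit ball which fixes the sphere pointwise does not map the ball
into the sphere. -/
theorem not_exists_retraction_closedBall {r : E → E}
    (hr : ∀ x ∈ closedBall (0 : E) 1, ContDiffAt ℝ 1 r x)
    (hmaps : ∀ x ∈ closedBall (0 : E) 1, ‖r x‖ = 1)
    (hfix : ∀ x ∈ sphere (0 : E) 1, r x = x) : False := by
  let _ : MeasurableSpace E := borel E
  have _ : BorelSpace E := ⟨rfl⟩
  have hB : IsCompact (closedBall (0 : E) 1) := isCompact_closedBall _ _
  obtain ⟨p, hp, hpB, hobt, hpid⟩ := exists_lipschitz_convex_projection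
    (nonempty_closedBall.2 zero_le_one) hB.isComplete (convex_closedBall (0 : E) 1)
  obtain ⟨Lr, hLr⟩ := LocallyLipschitzOn.exists_lipschitzOnWith_of_compact (f := r) hB
    (fun x hx => by
      obtain ⟨K, t, ht, hK⟩ := (hr x hx).exists_lipschitzOnWith
      exact ⟨K, t, mem_nhdsWithin_of_mem_nhds ht, hK⟩)
  have hderiv : ContinuousOn (fun x => fderiv ℝ r x - 1) (closedBall (0 : E) 1) := fun x hx =>
    (((hr x hx).fderiv_right (m := 0) le_rfl).continuousAt.sub
      continuousAt_const).continuousWithinAt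
  obtain ⟨C, hC⟩ := hB.exists_bound_of_continuousOn hderiv
  -- Precomposing with the projection extends the displacement `r - id` to a globally Lipschitz map
  -- that vanishes off the open ball.
  let u : E → E := fun x => r (p x) - p x
  have hu : LipschitzWith (Lr + 1) u := by
    have h1 : LipschitzWith Lr (r ∘ p) := by
      have := hLr.comp (hp.lipschitzOnWith (s := univ)) (fun x _ => hpB x)
      simpa using this
    exact h1.sub hp
  have hu_out : ∀ x, x ∉ ball (0 : E) 1 → u x = 0 := fun x hx => by
    refine sub_eq_zero.2 (hfix _ ?_)
    rw [mem_ball, dist_zero_right, not_lt] at hx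
    rw [mem_sphere, dist_zero_right]
    have hle : ‖p x‖ ≤ 1 := by simpa using hpB x
    refine hle.antisymm (not_lt.1 fun hlt => ?_)
    have hne : x - p x ≠ 0 := fun h => by
      rw [← sub_eq_zero.1 h] at hlt
      exact hlt.not_ge hx
    have hpos := norm_pos_iff.2 hne
    -- If `p x` were interior, one could step from it towards `x` by `1 - ‖p x‖` inside the ball,
    -- against the obtuse-angle inequality.
    have h := hobt x (p x + ((1 - ‖p x‖) / ‖x - p x‖) • (x - p x)) (by
      rw [mem_closedBall, dist_zero_right]
      refine (norm_add_le _ _).trans ?_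
      rw [norm_smul, Real.norm_of_nonneg (div_nonneg (by linarith) hpos.le),
        div_mul_cancel₀ _ hpos.ne']
      linarith)
    rw [add_sub_cancel_left, inner_smul_right] at h
    exact absurd (mul_pos (div_pos (sub_pos.2 hlt) hpos) (real_inner_self_pos.2 hne)) h.not_gt
  have hu_in : ∀ x ∈ ball (0 : E) 1, u x = r x - x := fun x hx => by
    simp only [u, hpid x (ball_subset_closedBall hx)]
  -- small multiples of `u` perturb the identity to a bijection of the ball
  have himage : ∀ t ∈ Ioo (0 : ℝ) 1, t * (Lr + 1) < 1 →
      InjOn (fun x => x + t • u x) (ball 0 1) ∧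
      (fun x => x + t • u x) '' ball (0 : E) 1 = ball 0 1 := fun t ht htL => by
    obtain ⟨τ, rfl⟩ : ∃ τ : NNReal, (τ : ℝ) = t := ⟨⟨t, ht.1.le⟩, rfl⟩
    have htu : LipschitzWith (τ * (Lr + 1)) fun x => (τ : ℝ) • u x :=
      LipschitzWith.of_dist_le_mul fun x y => by
        rw [dist_smul₀, Real.norm_of_nonneg ht.1.le]
        have := hu.dist_le_mul x y
        push_cast at this ⊢
        rw [mul_assoc]
        exact mul_le_mul_of_nonneg_left this ht.1.le
    refine ⟨fun x _ y _ hxy => ?_, Subset.antisymm ?_ fun y hy => ?_⟩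
    · have h := htu.dist_le_mul x y
      have h2 : dist ((τ : ℝ) • u x) ((τ : ℝ) • u y) = dist x y := by
        simp only at hxy
        have : x - y = -((τ : ℝ) • u x - (τ : ℝ) • u y) := by
          rw [eq_neg_iff_add_eq_zero, ← sub_eq_zero.2 hxy]; abel
        rw [dist_eq_norm, dist_eq_norm, this, norm_neg]
      rw [h2] at h
      push_cast at h
      by_contra hne
      have := dist_pos.2 hne
      nlinarith
    · rintro _ ⟨x, hx, rfl⟩
      have hx1 : ‖x‖ < 1 := by simpa using hx
      simp only [mem_ball, dist_zero_right, hu_in x hx]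
      calc ‖x + (τ : ℝ) • (r x - x)‖ = ‖(1 - (τ : ℝ)) • x + (τ : ℝ) • r x‖ := by congr 1; module
        _ ≤ ‖(1 - (τ : ℝ)) • x‖ + ‖(τ : ℝ) • r x‖ := norm_add_le _ _
        _ = (1 - (τ : ℝ)) * ‖x‖ + (τ : ℝ) := by
          rw [norm_smul, norm_smul, hmaps x (ball_subset_closedBall hx),
            Real.norm_of_nonneg ht.1.le, Real.norm_of_nonneg (by linarith [ht.2]), mul_one]
        _ < 1 := by nlinarith [ht.1, ht.2]
    -- Solving `x + t u(x) = y` is a fixed point problem for a contraction of the whole space. A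
    -- solution outside the ball would have `u x = 0`, hence equal `y`, which lies inside.
    · have hcon : ContractingWith (τ * (Lr + 1)) fun x => y - (τ : ℝ) • u x := by
        refine ⟨by exact_mod_cast htL, ?_⟩
        simpa using (LipschitzWith.const y).sub htu
      obtain ⟨x, hx⟩ : ∃ x, y - (τ : ℝ) • u x = x := ⟨_, hcon.fixedPoint_isFixedPt⟩
      refine ⟨x, ?_, ?_⟩
      · by_contra hxB
        rw [hu_out x hxB, smul_zero, sub_zero] at hx
        exact hxB (hx ▸ hy)
      · simp only
        nth_rewrite 1 [← hx]
        abel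
  -- Change of variables: for small `t` the perturbed identity maps the ball bijectively onto
  -- itself, with positive Jacobian.
  have hvol : ∀ t ∈ Ioo (0 : ℝ) 1, t * (Lr + 1) < 1 → t * C < 1 →
      ∫ x in ball (0 : E) 1, (1 + t • (fderiv ℝ r x - 1)).det = volume.real (ball (0 : E) 1) :=
    fun t ht htL htC => by
    obtain ⟨hinj, him⟩ := himage t ht htL
    have hd : ∀ x ∈ ball (0 : E) 1, HasFDerivWithinAt (fun x => x + t • u x)
        (1 + t • (fderiv ℝ r x - 1)) (ball 0 1) x := fun x hx => by
      have h1 := ((hr x (ball_subset_closedBall hx)).differentiableAt one_ne_zero).hasFDerivAt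
      have h2 := (hasFDerivAt_id x).add ((h1.sub (hasFDerivAt_id x)).const_smul t)
      refine (h2.hasFDerivWithinAt (s := ball 0 1)).congr (fun y hy => ?_) ?_
      · simp [hu_in y hy]
      · simp [hu_in x hx]
    have h := integral_image_eq_integral_abs_det_fderiv_smul volume measurableSet_ball hd hinj
      (fun _ => (1 : ℝ))
    rw [him] at h
    simp only [integral_const, smul_eq_mul, mul_one, measureReal_restrict_apply_univ] at h
    rw [h]
    refine setIntegral_congr_fun measurableSet_ball fun x hx => ?_
    refine (abs_of_pos (ContinuousLinearMap.det_one_add_pos ?_)).symm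
    rw [norm_smul, Real.norm_of_nonneg ht.1.le]
    exact (mul_le_mul_of_nonneg_left (hC x (ball_subset_closedBall hx)) ht.1.le).trans_lt htC
  have hC0 : 0 ≤ C := (norm_nonneg _).trans (hC 0 (mem_closedBall_self zero_le_one))
  -- This `δ` makes `t < 1`, `t (Lr + 1) < 1` and `t C < 1` hold together.
  obtain ⟨s, c, hs, hdet⟩ := ContinuousLinearMap.exists_det_one_add_eq_sum E
    (δ := 1 / (Lr + C + 2)) (by positivity)
  have hs' : ∀ t ∈ s, t ∈ Ioo (0 : ℝ) 1 ∧ t * (Lr + 1) < 1 ∧ t * C < 1 := fun t ht => by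
    have hpos : (0 : ℝ) < Lr + C + 2 := by positivity
    have hL0 : (0 : ℝ) ≤ Lr := Lr.2
    obtain ⟨h0, h1⟩ := hs t ht
    rw [lt_div_iff₀ hpos] at h1
    refine ⟨⟨h0, ?_⟩, ?_, ?_⟩ <;> nlinarith [mul_nonneg h0.le hL0, mul_nonneg h0.le hC0]
  have hint : ∀ t : ℝ, IntegrableOn (fun x => (1 + t • (fderiv ℝ r x - 1)).det)
      (ball (0 : E) 1) := fun t => by
    refine IntegrableOn.mono_set (ContinuousOn.integrableOn_compact hB ?_) ball_subset_closedBall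
    exact ContinuousLinearMap.continuous_det.comp_continuousOn
      (continuousOn_const.add (hderiv.const_smul t))
  -- The interpolation identity at `A = 0`.
  have hsum : ∑ t ∈ s, c t = 1 := by
    have h := hdet 0
    have h1 : (1 : E →L[ℝ] E).det = 1 := LinearMap.det_id
    simpa [h1] using h.symm
  have hfull : ∫ x in ball (0 : E) 1, (fderiv ℝ r x).det = volume.real (ball (0 : E) 1) := by
    calc ∫ x in ball (0 : E) 1, (fderiv ℝ r x).det
        = ∫ x in ball (0 : E) 1, ∑ t ∈ s, c t * (1 + t • (fderiv ℝ r x - 1)).det := by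
          congr 1 with x
          rw [← hdet, add_sub_cancel]
      _ = ∑ t ∈ s, c t * ∫ x in ball (0 : E) 1, (1 + t • (fderiv ℝ r x - 1)).det := by
          rw [integral_finsetSum _ fun t _ => (hint t).const_mul _]
          exact Finset.sum_congr rfl fun t _ => integral_const_mul _ _
      _ = ∑ t ∈ s, c t * volume.real (ball (0 : E) 1) :=
          Finset.sum_congr rfl fun t ht => by
            rw [hvol t (hs' t ht).1 (hs' t ht).2.1 (hs' t ht).2.2]
      _ = volume.real (ball (0 : E) 1) := by rw [← Finset.sum_mul, hsum, one_mul]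
  -- Since `‖r‖² = 1` on the ball, the range of the derivative is orthogonal to `r x ≠ 0`, so the
  -- derivative is not surjective. This contradicts `hfull`, where the integral is the positive
  -- volume of the ball.
  have hzero : ∀ x ∈ ball (0 : E) 1, (fderiv ℝ r x).det = 0 := fun x hx => by
    have h1 := ((hr x (ball_subset_closedBall hx)).differentiableAt one_ne_zero).hasFDerivAt
    have h2 := h1.norm_sq
    have h3 : HasFDerivAt (fun y => ‖r y‖ ^ 2) (0 : E →L[ℝ] ℝ) x := by
      refine (hasFDerivAt_const (1 : ℝ) x).congr_of_eventuallyEq ?_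
      filter_upwards [isOpen_ball.mem_nhds hx] with y hy
      rw [hmaps y (ball_subset_closedBall hy), one_pow]
    have h4 := h2.unique h3
    by_contra hne
    have hsurj : Function.Surjective (fderiv ℝ r x) :=
      ((LinearMap.equivOfDetNeZero _ hne).surjective)
    obtain ⟨v, hv⟩ := hsurj (r x)
    have h5 := congrArg (fun f : E →L[ℝ] ℝ => f v) h4
    simp [hv, hmaps x (ball_subset_closedBall hx)] at h5
  have : volume.real (ball (0 : E) 1) = 0 := by
    rw [← hfull]
    exact setIntegral_eq_zero_of_forall_eq_zero hzero
  exact (ENNReal.toReal_pos (measure_ball_pos volume (0 : E) one_pos).ne'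
    measure_ball_lt_top.ne).ne' this

/-- **Brouwer's fixed point theorem** for `C¹` maps of the closed unit ball. -/
theorem exists_fixedPoint_closedBall_of_contDiff {F : E → E} (hF : ContDiff ℝ 1 F)
    (hmaps : MapsTo F (closedBall 0 1) (closedBall 0 1)) :
    ∃ x ∈ closedBall (0 : E) 1, F x = x := by
  by_contra! hne
  let w : E → E := fun x => x - F x
  have hw : ContDiff ℝ 1 w := contDiff_id.sub hF
  -- A quarter of the discriminant of `‖x + σ w‖² = 1` as a quadratic equation in `σ`. Its
  -- positivity on the ball keeps the square root smooth.
  let D : E → ℝ := fun x => inner ℝ x (w x) ^ 2 + ‖w x‖ ^ 2 * (1 - ‖x‖ ^ 2)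
  have hD : ContDiff ℝ 1 D :=
    ((contDiff_id.inner ℝ hw).pow 2).add
      ((hw.norm_sq ℝ).mul (contDiff_const.sub (contDiff_norm_sq ℝ)))
  have hw0 : ∀ x ∈ closedBall (0 : E) 1, 0 < ‖w x‖ ^ 2 := fun x hx =>
    pow_pos (norm_pos_iff.2 (sub_ne_zero.2 (hne x hx).symm)) 2
  have hinner : ∀ x : E, ‖x‖ = 1 → 0 < inner ℝ x (w x) := fun x hx => by
    have hxB : x ∈ closedBall (0 : E) 1 := by simp [hx]
    have hFx : ‖F x‖ ≤ 1 := by simpa using hmaps hxB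
    have h1 : inner ℝ x (w x) = 1 - inner ℝ x (F x) := by
      rw [inner_sub_right, real_inner_self_eq_norm_sq, hx, one_pow]
    have h2 := hw0 x hxB
    rw [norm_sub_sq_real, hx] at h2
    nlinarith [norm_nonneg (F x)]
  have hDpos : ∀ x ∈ closedBall (0 : E) 1, 0 < D x := fun x hx => by
    have hx1 : ‖x‖ ≤ 1 := by simpa using hx
    rcases hx1.eq_or_lt with h | h
    · simp only [D, h]
      have := hinner x h
      simp only [one_pow, sub_self, mul_zero, add_zero]
      positivity
    · have h2 : 0 < 1 - ‖x‖ ^ 2 := by nlinarith [norm_nonneg x]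
      exact add_pos_of_nonneg_of_pos (sq_nonneg _) (mul_pos (hw0 x hx) h2)
  -- The larger root: the ray from `F x` through `x` leaves the ball at `x + σ w`. On the sphere
  -- `(x, w) > 0`, so this root is `0` and the point is fixed.
  let σ : E → ℝ := fun x => (-inner ℝ x (w x) + Real.sqrt (D x)) / ‖w x‖ ^ 2
  refine not_exists_retraction_closedBall (r := fun x => x + σ x • w x) (fun x hx => ?_)
    (fun x hx => ?_) fun x hx => ?_
  · have h1 : ContDiffAt ℝ 1 σ x :=
      ((contDiff_id.inner ℝ hw).contDiffAt.neg.add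
        (hD.contDiffAt.sqrt (hDpos x hx).ne')).div (hw.norm_sq ℝ).contDiffAt (hw0 x hx).ne'
    exact contDiffAt_id.add (h1.smul hw.contDiffAt)
  · have h1 : σ x * ‖w x‖ ^ 2 = -inner ℝ x (w x) + Real.sqrt (D x) :=
      div_mul_cancel₀ _ (hw0 x hx).ne'
    have h2 := Real.sq_sqrt (hDpos x hx).le
    have h3 : ‖x + σ x • w x‖ ^ 2 = 1 := by
      rw [norm_add_sq_real, inner_smul_right, norm_smul, mul_pow, Real.norm_eq_abs, sq_abs]
      have h4 : (σ x * ‖w x‖ ^ 2 + inner ℝ x (w x)) ^ 2 = D x := by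
        rw [h1, neg_add_cancel_comm, h2]
      have h5 := (hw0 x hx).ne'
      have h6 : ‖w x‖ ^ 2 * (‖x‖ ^ 2 + 2 * (σ x * inner ℝ x (w x)) + σ x ^ 2 * ‖w x‖ ^ 2)
          = ‖w x‖ ^ 2 * 1 := by
        simp only [D] at h4
        linear_combination h4
      exact mul_left_cancel₀ h5 h6
    have h7 := norm_nonneg (x + σ x • w x)
    nlinarith
  · have hx1 : ‖x‖ = 1 := by simpa using hx
    have : σ x = 0 := by
      simp only [σ, D, hx1, one_pow, sub_self, mul_zero, add_zero,
        Real.sqrt_sq (hinner x hx1).le, neg_add_cancel, zero_div]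
    simp [this]

/-- **Brouwer's fixed point theorem** for the closed unit ball. -/
theorem exists_fixedPoint_closedBall_one {F : E → E} (hF : Continuous F)
    (hmaps : MapsTo F (closedBall 0 1) (closedBall 0 1)) :
    ∃ x ∈ closedBall (0 : E) 1, F x = x := by
  let _ : MeasurableSpace E := borel E
  have _ : BorelSpace E := ⟨rfl⟩
  have hB : IsCompact (closedBall (0 : E) 1) := isCompact_closedBall _ _
  obtain ⟨x, hx, hmin⟩ := hB.exists_isMinOn (nonempty_closedBall.2 zero_le_one)
    (f := fun x => ‖F x - x‖) (by fun_prop)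
  refine ⟨x, hx, ?_⟩
  by_contra hne
  have hpos : 0 < ‖F x - x‖ := norm_pos_iff.2 (sub_ne_zero.2 hne)
  -- An `ε`-approximation rescaled into the ball has a fixed point that `F` moves by at most `2ε`,
  -- less than the minimal displacement `3ε`.
  set ε := ‖F x - x‖ / 3 with hε
  have hε0 : 0 < ε := by positivity
  obtain ⟨H, hH, hHF, -⟩ := hF.exists_contDiff_approx 1 (ε := fun _ => ε) continuous_const
    fun _ => hε0
  have hHn : ∀ y ∈ closedBall (0 : E) 1, ‖H y‖ ≤ 1 + ε := fun y hy => by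
    have h1 : ‖F y‖ ≤ 1 := by simpa using hmaps hy
    have h2 := (hHF y).le
    rw [dist_eq_norm] at h2
    calc ‖H y‖ = ‖F y + (H y - F y)‖ := by congr 1; abel
      _ ≤ 1 + ε := (norm_add_le _ _).trans (add_le_add h1 h2)
  obtain ⟨y, hy, hfix⟩ := exists_fixedPoint_closedBall_of_contDiff
    (F := fun y => (1 + ε)⁻¹ • H y) (contDiff_const.smul hH) fun y hy => by
      rw [mem_closedBall, dist_zero_right, norm_smul, norm_inv,
        Real.norm_of_nonneg (by positivity)]
      exact inv_mul_le_one_of_le₀ (hHn y hy) (by positivity)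
  have hHy : H y = (1 + ε) • y := by
    nth_rewrite 2 [← hfix]
    rw [smul_inv_smul₀ (by positivity)]
  have hy1 : ‖y‖ ≤ 1 := by simpa using hy
  have h1 : ‖F y - y‖ ≤ 2 * ε := by
    have h2 := (hHF y).le
    rw [dist_comm, dist_eq_norm] at h2
    calc ‖F y - y‖ = ‖(F y - H y) + ε • y‖ := by rw [hHy]; congr 1; module
      _ ≤ ε + ε * 1 := by
        refine (norm_add_le _ _).trans (add_le_add h2 ?_)
        rw [norm_smul, Real.norm_of_nonneg hε0.le]
        exact mul_le_mul_of_nonneg_left hy1 hε0.le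
      _ = 2 * ε := by ring
  have h3 : ‖F x - x‖ ≤ ‖F y - y‖ := hmin hy
  linarith

/-- **Brouwer's fixed point theorem** for a compact convex set. -/
theorem exists_fixedPoint_of_isCompact_convex {K : Set E} (hne : K.Nonempty) (hK : IsCompact K)
    (hconv : Convex ℝ K) {F : E → E} (hF : Continuous F) (hmaps : MapsTo F K K) :
    ∃ x ∈ K, F x = x := by
  obtain ⟨p, hp, hpK, -, hpid⟩ := exists_lipschitz_convex_projection hne hK.isComplete hconv
  obtain ⟨R, hR0, hR⟩ := hK.isBounded.exists_pos_norm_le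
  obtain ⟨x, -, hfix⟩ := exists_fixedPoint_closedBall_one (F := fun x => R⁻¹ • F (p (R • x)))
    ((hF.comp (hp.continuous.comp (continuous_const_smul R))).const_smul R⁻¹) fun x _ => by
      rw [mem_closedBall, dist_zero_right, norm_smul, norm_inv, Real.norm_of_nonneg hR0.le]
      exact inv_mul_le_one_of_le₀ (hR _ (hmaps (hpK _))) hR0.le
  have hx : F (p (R • x)) = R • x := by
    nth_rewrite 2 [← hfix]
    rw [smul_inv_smul₀ hR0.ne']
  have hxK : R • x ∈ K := hx ▸ hmaps (hpK _)
  exact ⟨R • x, hxK, by rwa [hpid _ hxK] at hx⟩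

/-- **Hartman–Stampacchia theorem**: a continuous variational inequality on a nonempty compact
convex set has a solution. -/
theorem SOL_nonempty {K : Set E} (hne : K.Nonempty) (hK : IsCompact K) (hconv : Convex ℝ K)
    {T : E → E} (hT : Continuous T) : (SOL K T).Nonempty := by
  obtain ⟨p, hp, hpK, hobt, -⟩ := exists_lipschitz_convex_projection hne hK.isComplete hconv
  -- At a fixed point of `x ↦ p (x - T x)` the obtuse-angle inequality is the variational
  -- inequality.
  obtain ⟨x, hxK, hx⟩ := exists_fixedPoint_of_isCompact_convex hne hK hconv
    (F := fun x => p (x - T x)) (hp.continuous.comp (continuous_id.sub hT)) fun x _ => hpK _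
  refine ⟨x, hxK, fun z hz => ?_⟩
  have h := hobt (x - T x) z hz
  rw [hx, sub_sub_cancel_left, inner_neg_left] at h
  linarith

end Brouwer

/-! ### First-order conditions for convex functions. -/

section FirstOrder

variable {E : Type*} [NormedAddCommGroup E] [NormedSpace ℝ E]

/-- On the line through `x` and `y`, the derivative at `0` is at most the slope over `[0, 1]`. -/
theorem ConvexOn.add_fderiv_sub_le {f : E → ℝ} {f' : E →L[ℝ] ℝ} {x : E}
    (hf : ConvexOn ℝ Set.univ f) (hf' : HasFDerivAt f f' x) (y : E) :
    f x + f' (y - x) ≤ f y := by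
  have hline : ConvexOn ℝ Set.univ fun t : ℝ => f (AffineMap.lineMap x y t) :=
    hf.comp_affineMap (AffineMap.lineMap x y)
  have hd : HasDerivAt (fun t : ℝ => f (AffineMap.lineMap x y t)) (f' (y - x)) 0 := by
    have h0 : (AffineMap.lineMap x y : ℝ →ᵃ[ℝ] E) 0 = x := AffineMap.lineMap_apply_zero x y
    exact HasFDerivAt.comp_hasDerivAt (0 : ℝ) (by rwa [h0]) AffineMap.hasDerivAt_lineMap
  have h := hline.le_slope_of_hasDerivAt (Set.mem_univ 0) (Set.mem_univ 1) one_pos hd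
  simp only [slope_def_field, AffineMap.lineMap_apply_one, AffineMap.lineMap_apply_zero, sub_zero,
    div_one] at h
  linarith

theorem ConvexOn.forall_le_iff_fderiv_nonneg {f : E → ℝ} {f' : E →L[ℝ] ℝ} {x : E}
    (hf : ConvexOn ℝ Set.univ f) (hf' : HasFDerivAt f f' x) {S : Set E} (hS : Convex ℝ S)
    (hx : x ∈ S) : (∀ y ∈ S, f x ≤ f y) ↔ ∀ y ∈ S, 0 ≤ f' (y - x) := by
  refine ⟨fun h y hy => ?_, fun h y hy => ?_⟩
  · have hmin : IsLocalMinOn f S x := IsMinOn.localize fun z hz => h z hz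
    exact hmin.hasFDerivWithinAt_nonneg hf'.hasFDerivWithinAt
      (sub_mem_posTangentConeAt_of_segment_subset (hS.segment_subset hx hy))
  · linarith [h y hy, hf.add_fderiv_sub_le hf' y]

end FirstOrder

/-! ### Calculus on the block space of joint actions. -/

section JointSpace

variable {N : ℕ} {d : Fin N → ℕ}

/-- The inclusion of the actions of player `i` into the joint actions. -/
noncomputable def blockSingle (i : Fin N) : ActionSpace (d i) →L[ℝ] JointSpace d :=
  LinearMap.toContinuousLinearMap
    { toFun := fun w => PiLp.single 2 i w
      map_add' := fun x y => PiLp.single_add 2 i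
      map_smul' := fun c x => by ext j : 1; by_cases h : j = i <;> [(subst h; simp); simp [h]] }

theorem blockSingle_apply (i : Fin N) (v : ActionSpace (d i)) :
    (blockSingle i v : JointSpace d) = PiLp.single 2 i v := rfl

theorem deviate_eq_add_blockSingle (a : JointSpace d) (i : Fin N) (x : ActionSpace (d i)) :
    deviate a i x = a + blockSingle i (x - a i) := by
  ext j : 1
  by_cases h : j = i
  · subst h; simp [deviate, blockSingle_apply]
  · simp [deviate, h, blockSingle_apply]

theorem deviate_self (a : JointSpace d) (i : Fin N) : deviate a i (a i) = a := by
  simp [deviate]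

theorem sum_blockSingle (v : JointSpace d) : ∑ i, blockSingle i (v i) = v := by
  ext j : 1
  rw [WithLp.ofLp_sum, Finset.sum_apply]
  simp [blockSingle_apply]

theorem inner_partialD {F : JointSpace d → ℝ} {a : JointSpace d}
    (hF : DifferentiableAt ℝ F a) (i : Fin N) (v : ActionSpace (d i)) :
    inner ℝ (WithLp.toLp 2 fun k => partialD F a i k : ActionSpace (d i)) v =
      fderiv ℝ F a (blockSingle i v) := by
  have hv : v = ∑ k, v k • EuclideanSpace.single k (1 : ℝ) := by
    ext k
    simp [Pi.single_apply]
  conv_rhs => rw [hv]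
  simp only [map_sum, map_smul]
  rw [PiLp.inner_apply]
  refine Finset.sum_congr rfl fun k _ => ?_
  rw [PiLp.toLp_apply, partialD, hF.lineDeriv_eq_fderiv]
  rfl

theorem hasFDerivAt_comp_deviate {F : JointSpace d → ℝ} {a : JointSpace d}
    (hF : DifferentiableAt ℝ F a) (i : Fin N) :
    HasFDerivAt (fun x => F (deviate a i x)) ((fderiv ℝ F a).comp (blockSingle i)) (a i) := by
  have hι : HasFDerivAt (fun x => deviate a i x) (blockSingle i : _ →L[ℝ] JointSpace d) (a i) := by
    have h := ((blockSingle i : _ →L[ℝ] JointSpace d).hasFDerivAt (x := a i)).const_add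
      (a - blockSingle i (a i))
    refine h.congr_of_eventuallyEq (Filter.Eventually.of_forall fun x => ?_)
    simp only [deviate_eq_add_blockSingle, map_sub]
    abel
  refine HasFDerivAt.comp (a i) (g := F) ?_ hι
  rw [deviate_self]
  exact hF.hasFDerivAt

theorem isCompact_setOf_forall_mem {ι : Type*} {X : ι → Type*} [Fintype ι]
    [∀ i, SeminormedAddCommGroup (X i)] {S : ∀ i, Set (X i)} (hS : ∀ i, IsCompact (S i)) :
    IsCompact {x : PiLp 2 X | ∀ i, x i ∈ S i} := by
  convert (isCompact_univ_pi hS).image (PiLp.continuous_toLp 2 X) using 1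
  ext x
  constructor
  · exact fun h => ⟨x.ofLp, fun i _ => h i, rfl⟩
  · rintro ⟨y, hy, rfl⟩ i
    exact hy i trivial

theorem norm_le_sum_of_mem_nonnegOrthant {n : ℕ} {l : ActionSpace n} (hl : l ∈ nonnegOrthant n) :
    ‖l‖ ≤ ∑ k, l k := by
  rw [EuclideanSpace.norm_eq]
  refine Real.sqrt_le_iff.2 ⟨Finset.sum_nonneg fun k _ => hl k, ?_⟩
  simp only [Real.norm_eq_abs, sq_abs]
  exact Finset.sum_sq_le_sq_sum_of_nonneg fun k _ => hl k

end JointSpace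

/-! ### Equilibria as solutions of the variational inequality. -/

namespace Game

variable {N n : ℕ} {d : Fin N → ℕ} {G : Game N n d}

/-- The cost `J_i(a) + (l, g(a))` of a regular player in the associated game, as a function of the
joint action. -/
noncomputable def regularCost (G : Game N n d) (l : ActionSpace n) (i : Fin N)
    (a : JointSpace d) : ℝ :=
  G.J i a + inner ℝ l (G.g a)

/-- The first-order conditions of the regular players at `a`, against the dual action `l`. -/
def SolvesRegularVI (G : Game N n d) (a : JointSpace d) (l : ActionSpace n) : Prop :=
  ∀ z ∈ G.jointA, 0 ≤ ∑ i, fderiv ℝ (G.regularCost l i) a (blockSingle i (z i - a i))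

theorem IsConvex.differentiable_J (hG : G.IsConvex) (i : Fin N) : Differentiable ℝ (G.J i) :=
  (hG.contDiff_J i).differentiable one_ne_zero

theorem IsConvex.hasFDerivAt_inner_g (hG : G.IsConvex) (l : ActionSpace n) (a : JointSpace d) :
    HasFDerivAt (fun a => inner ℝ l (G.g a)) ((innerSL ℝ l).comp (fderiv ℝ G.g a)) a :=
  (innerSL ℝ l).hasFDerivAt.comp a (hG.contDiff_g.differentiable one_ne_zero a).hasFDerivAt

theorem IsConvex.differentiable_inner_g (hG : G.IsConvex) (l : ActionSpace n) :
    Differentiable ℝ fun a => inner ℝ l (G.g a) :=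
  fun a => (hG.hasFDerivAt_inner_g l a).differentiableAt

theorem IsConvex.differentiable_regularCost (hG : G.IsConvex) (l : ActionSpace n) (i : Fin N) :
    Differentiable ℝ (G.regularCost l i) :=
  (hG.differentiable_J i).add (hG.differentiable_inner_g l)

theorem IsConvex.fderiv_regularCost (hG : G.IsConvex) (l : ActionSpace n) (i : Fin N)
    (a : JointSpace d) : fderiv ℝ (G.regularCost l i) a =
      fderiv ℝ (G.J i) a + fderiv ℝ (fun a => inner ℝ l (G.g a)) a :=
  fderiv_add (hG.differentiable_J i a) (hG.differentiable_inner_g l a)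

theorem IsConvex.convexOn_inner_g (hG : G.IsConvex) {l : ActionSpace n}
    (hl : l ∈ nonnegOrthant n) : ConvexOn ℝ Set.univ fun a => inner ℝ l (G.g a) := by
  have h : (fun a => inner ℝ l (G.g a)) = ∑ k, fun a => l k • G.g a k := by
    ext a
    rw [PiLp.inner_apply, Finset.sum_apply]
    exact Finset.sum_congr rfl fun k _ => by simp [mul_comm]
  rw [h]
  exact Finset.sum_induction _ (fun f : JointSpace d → ℝ => ConvexOn ℝ Set.univ f)
    (fun _ _ hf hg => hf.add hg) (convexOn_const 0 convex_univ)
    fun k _ => (hG.convex_g k).smul (hl k)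

theorem IsConvex.convexOn_regularCost (hG : G.IsConvex) {l : ActionSpace n}
    (hl : l ∈ nonnegOrthant n) (a : JointSpace d) (i : Fin N) :
    ConvexOn ℝ Set.univ fun x => G.regularCost l i (deviate a i x) := by
  refine (hG.convex_J i a).add ?_
  have h : (fun x => inner ℝ l (G.g (deviate a i x))) = (fun a => inner ℝ l (G.g a)) ∘
      (((blockSingle i).toLinearMap.toAffineMap : ActionSpace (d i) →ᵃ[ℝ] JointSpace d) +
        AffineMap.const ℝ (ActionSpace (d i)) (a - blockSingle i (a i))) := by
    ext x
    simp only [deviate_eq_add_blockSingle, map_sub, Function.comp_apply, AffineMap.coe_add,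
      Pi.add_apply, AffineMap.const_apply, LinearMap.coe_toAffineMap, ContinuousLinearMap.coe_coe]
    congr 2
    abel
  change ConvexOn ℝ Set.univ fun x => inner ℝ l (G.g (deviate a i x))
  rw [h]
  exact (hG.convexOn_inner_g hl).comp_affineMap _

theorem deviate_mem_jointA {a : JointSpace d} (ha : a ∈ G.jointA) {i : Fin N}
    {x : ActionSpace (d i)} (hx : x ∈ G.A i) : deviate a i x ∈ G.jointA := fun j => by
  by_cases h : j = i
  · subst h; simpa [deviate] using hx
  · simpa [deviate, h] using ha j

/-- `A` is a product, so testing with unilateral deviations isolates each summand. -/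
theorem solvesRegularVI_iff {a : JointSpace d} {l : ActionSpace n} (ha : a ∈ G.jointA) :
    G.SolvesRegularVI a l ↔ ∀ i, ∀ x ∈ G.A i,
      0 ≤ fderiv ℝ (G.regularCost l i) a (blockSingle i (x - a i)) := by
  refine ⟨fun h i x hx => ?_, fun h z hz => Finset.sum_nonneg fun i _ => h i _ (hz i)⟩
  have h1 := h _ (deviate_mem_jointA ha hx)
  rw [Finset.sum_eq_single i] at h1
  · simpa [deviate] using h1
  · intro j _ hj
    simp [deviate, hj]
  · simp

theorem IsConvex.solvesRegularVI_iff_forall_le (hG : G.IsConvex) {a : JointSpace d}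
    {l : ActionSpace n} (ha : a ∈ G.jointA) (hl : l ∈ nonnegOrthant n) :
    G.SolvesRegularVI a l ↔
      ∀ i, ∀ x ∈ G.A i, G.regularCost l i a ≤ G.regularCost l i (deviate a i x) := by
  rw [solvesRegularVI_iff ha]
  refine forall_congr' fun i => ?_
  have h := (hG.convexOn_regularCost hl a i).forall_le_iff_fderiv_nonneg
    (hasFDerivAt_comp_deviate (hG.differentiable_regularCost l i a) i) (hG.convex_A i) (ha i)
  simp only [deviate_self] at h
  exact h.symm

theorem isAssocNash_iff {a : JointSpace d} {l : ActionSpace n} :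
    G.IsAssocNash a l ↔ a ∈ G.jointA ∧ l ∈ nonnegOrthant n ∧
      (∀ i, ∀ x ∈ G.A i, G.regularCost l i a ≤ G.regularCost l i (deviate a i x)) ∧
      ∀ m ∈ nonnegOrthant n, inner ℝ m (G.g a) ≤ inner ℝ l (G.g a) := by
  have hreg : ∀ (i : Fin N) (x : ActionSpace (d i)),
      regularPart (Function.update (assocProfile a l) (some i) x) = deviate a i x := fun i x => by
    ext j : 1
    by_cases h : j = i
    · subst h; simp [regularPart, deviate]
    · have h' : (some j : Option (Fin N)) ≠ some i := fun e => h (Option.some.inj e)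
      simp [regularPart, deviate, h, h', assocProfile]
  have hdual : ∀ m : ActionSpace n,
      regularPart (Function.update (assocProfile a l) none m) = a := fun m => by
    ext j : 1
    simp [regularPart, assocProfile]
  have hself : regularPart (assocProfile a l) = a := rfl
  unfold IsAssocNash IsNashEquilibrium
  simp only [Option.forall]
  constructor
  · rintro ⟨⟨h1, h2⟩, h3, h4⟩
    refine ⟨h2, h1, fun i x hx => ?_, fun m hm => ?_⟩
    · have h := h4 i x hx
      simp only [assocCost, hreg, hself] at h
      rwa [Function.update_of_ne (by simp)] at h
    · have h := h3 m hm
      simp only [assocCost, hdual, hself, Function.update_self] at h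
      exact neg_le_neg_iff.1 h
  · rintro ⟨h1, h2, h3, h4⟩
    refine ⟨⟨h2, h1⟩, fun m hm => ?_, fun i x hx => ?_⟩
    · simp only [assocCost, hdual, hself, Function.update_self]
      exact neg_le_neg_iff.2 (h4 m hm)
    · simp only [assocCost, hreg, hself]
      rw [Function.update_of_ne (by simp)]
      exact h3 i x hx

/-- Each summand differentiates a different player's cost, so the sum need not be the derivative of
a single function. -/
theorem IsConvex.inner_M0 (hG : G.IsConvex) (a z : JointSpace d) (l m : ActionSpace n) :
    inner ℝ (G.M0 (WithLp.toLp 2 (a, l))) (WithLp.toLp 2 (z, m) - WithLp.toLp 2 (a, l)) =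
      (∑ i, fderiv ℝ (G.regularCost l i) a (blockSingle i (z i - a i))) -
        inner ℝ (m - l) (G.g a) := by
  rw [WithLp.prod_inner_apply, sub_eq_add_neg]
  congr 1
  · rw [PiLp.inner_apply]
    refine Finset.sum_congr rfl fun i _ => ?_
    rw [hG.fderiv_regularCost, add_apply,
      ← inner_partialD (hG.differentiable_J i a), ← inner_partialD (hG.differentiable_inner_g l a),
      ← inner_add_left]
    rfl
  · rw [← inner_neg_right, real_inner_comm]
    rfl

/-- The variational inequality of `M⁰` on `A × P` separates into the first-order conditions of the
regular players and the optimality of the dual player. -/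
theorem IsConvex.mem_SOL_iff (hG : G.IsConvex) {P : Set (ActionSpace n)} {a : JointSpace d}
    {l : ActionSpace n} :
    (WithLp.toLp 2 (a, l) : ExtSpace d n) ∈ SOL {η | η.fst ∈ G.jointA ∧ η.snd ∈ P} G.M0 ↔
      a ∈ G.jointA ∧ l ∈ P ∧ G.SolvesRegularVI a l ∧
        ∀ m ∈ P, inner ℝ m (G.g a) ≤ inner ℝ l (G.g a) := by
  constructor
  · rintro ⟨⟨ha, hl⟩, h⟩
    refine ⟨ha, hl, fun z hz => ?_, fun m hm => ?_⟩
    · have h1 := h (WithLp.toLp 2 (z, l)) ⟨hz, hl⟩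
      rwa [hG.inner_M0, sub_self, inner_zero_left, sub_zero] at h1
    · have h1 := h (WithLp.toLp 2 (a, m)) ⟨ha, hm⟩
      rw [hG.inner_M0, inner_sub_left] at h1
      simp only [sub_self, map_zero, Finset.sum_const_zero] at h1
      linarith
  · rintro ⟨ha, hl, hreg, hdual⟩
    refine ⟨⟨ha, hl⟩, fun ζ hζ => ?_⟩
    have h1 := hreg _ hζ.1
    have h2 := hdual _ hζ.2
    change 0 ≤ inner ℝ _ (WithLp.toLp 2 (ζ.fst, ζ.snd) - _)
    rw [hG.inner_M0, inner_sub_left]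
    linarith

theorem IsConvex.isAssocNash_iff_mem_SOL (hG : G.IsConvex) {a : JointSpace d}
    {l : ActionSpace n} :
    G.IsAssocNash a l ↔ (WithLp.toLp 2 (a, l) : ExtSpace d n) ∈ SOL G.extSet G.M0 := by
  rw [isAssocNash_iff]
  refine Iff.trans ?_ (hG.mem_SOL_iff (P := nonnegOrthant n)).symm
  refine and_congr_right fun ha => and_congr_right fun hl => and_congr_left fun _ => ?_
  exact (hG.solvesRegularVI_iff_forall_le ha hl).symm

theorem inner_nonpos_of_mem_nonnegOrthant {l v : ActionSpace n} (hl : l ∈ nonnegOrthant n)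
    (hv : ∀ k, v k ≤ 0) : inner ℝ l v ≤ 0 := by
  rw [PiLp.inner_apply]
  exact Finset.sum_nonpos fun k _ => mul_nonpos_of_nonpos_of_nonneg (hv k) (hl k)

theorem zero_mem_nonnegOrthant : (0 : ActionSpace n) ∈ nonnegOrthant n := fun _ => le_rfl

/-- Raising `l_k` by one shows `g_k(a) ≤ 0`; playing `0` shows `(l, g(a)) ≥ 0`. Together they give
complementarity. -/
theorem IsAssocNash.isGNE {a : JointSpace d} {l : ActionSpace n} (h : G.IsAssocNash a l) :
    G.IsGNE a := by
  obtain ⟨ha, hl, hreg, hdual⟩ := isAssocNash_iff.1 h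
  have hg : ∀ k, G.g a k ≤ 0 := fun k => by
    have h1 := hdual (l + EuclideanSpace.single k 1) fun j => by
      have := hl j
      by_cases hj : j = k <;> simp [hj] <;> [(subst hj; linarith); linarith]
    rw [inner_add_left, EuclideanSpace.inner_single_left] at h1
    simpa using h1
  have hzero : inner ℝ l (G.g a) = 0 :=
    (inner_nonpos_of_mem_nonnegOrthant hl hg).antisymm
      (by simpa using hdual 0 zero_mem_nonnegOrthant)
  refine ⟨⟨ha, ha, hg⟩, fun i x hx => ?_⟩
  have h1 := hreg i x hx.1
  have h2 := inner_nonpos_of_mem_nonnegOrthant hl hx.2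
  simp only [regularCost, hzero] at h1
  linarith

/-! ### Bound on the multipliers from Slater's condition. -/

theorem IsConvex.isCompact_jointA (hG : G.IsConvex) : IsCompact G.jointA :=
  isCompact_setOf_forall_mem hG.compact_A

theorem IsConvex.convex_jointA (hG : G.IsConvex) : Convex ℝ G.jointA :=
  fun _ hx _ hy _ _ hs ht hst i => hG.convex_A i (hx i) (hy i) hs ht hst

theorem Slater.exists_strictly_feasible (hS : G.Slater) :
    ∃ ε : ℝ, 0 < ε ∧ ∃ b ∈ G.jointA, ∀ k, G.g b k ≤ -ε := by
  obtain ⟨m, h, -, hA, b, hb, hg⟩ := hS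
  have h1 : ∀ᶠ ε : ℝ in nhdsWithin 0 (Set.Ioi 0), ∀ k, ε < -G.g b k :=
    Filter.eventually_all.2 fun k => nhdsWithin_le_nhds (eventually_lt_nhds (neg_pos.2 (hg k)))
  obtain ⟨ε, h2, h3⟩ := (h1.and self_mem_nhdsWithin).exists
  refine ⟨ε, h3, b, fun i => ?_, fun k => by linarith [h2 k]⟩
  rw [hA i]
  exact fun j => (hb i j).le

/-- Multipliers at which the regular players are optimal and complementarity holds in one direction
are bounded under Slater's condition. -/
theorem IsConvex.exists_norm_le (hG : G.IsConvex) (hS : G.Slater) :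
    ∃ K : ℝ, 0 < K ∧ ∀ (a : JointSpace d) (l : ActionSpace n), a ∈ G.jointA →
      l ∈ nonnegOrthant n → G.SolvesRegularVI a l → 0 ≤ inner ℝ l (G.g a) → ‖l‖ ≤ K := by
  obtain ⟨ε, hε, b, hb, hgb⟩ := hS.exists_strictly_feasible
  have hcont : Continuous fun a => ∑ i, fderiv ℝ (G.J i) a (blockSingle i (b i - a i)) := by
    refine continuous_finsetSum _ fun i _ => ?_
    refine ((hG.contDiff_J i).continuous_fderiv one_ne_zero).clm_apply ?_
    fun_prop
  obtain ⟨C, hC⟩ := hG.isCompact_jointA.exists_bound_of_continuousOn hcont.continuousOn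
  have hC0 : 0 ≤ C := (norm_nonneg _).trans (hC b hb)
  -- `C` bounds the total derivative of the costs `J` towards `b`. The argument gives `‖l‖ ≤ C / ε`;
  -- adding `1` makes the constant positive.
  refine ⟨C / ε + 1, by positivity, fun a l ha hl hreg hcomp => ?_⟩
  have h1 := hreg b hb
  simp only [hG.fderiv_regularCost, add_apply, Finset.sum_add_distrib] at h1
  -- The constraint term is common to all players, so its block derivatives add up to the full
  -- derivative along `b - a`.
  rw [← map_sum] at h1
  have h2 : ∑ i, blockSingle i (b i - a i) = b - a := sum_blockSingle (b - a)
  rw [h2] at h1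
  have h3 := (hG.convexOn_inner_g hl).add_fderiv_sub_le
    (hG.differentiable_inner_g l a).hasFDerivAt b
  have h4 := (le_abs_self _).trans (hC a ha)
  have h5 : inner ℝ l (G.g b) ≤ -ε * ∑ k, l k := by
    rw [PiLp.inner_apply, Finset.mul_sum]
    exact Finset.sum_le_sum fun k _ => mul_le_mul_of_nonneg_right (hgb k) (hl k)
  have h6 := mul_le_mul_of_nonneg_left (norm_le_sum_of_mem_nonnegOrthant hl) hε.le
  have h7 : ‖l‖ ≤ C / ε := by
    rw [le_div_iff₀ hε]
    linarith
  linarith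

/-! ### Existence by truncating the dual action set. -/

theorem IsConvex.continuous_M0 (hG : G.IsConvex) : Continuous G.M0 := by
  have hfst : Continuous fun η : ExtSpace d n => η.fst := by fun_prop
  have hsnd : Continuous fun η : ExtSpace d n => η.snd := by fun_prop
  have hJ : ∀ i k, Continuous fun η : ExtSpace d n => partialD (G.J i) η.fst i k := fun i k => by
    simp only [partialD, (hG.differentiable_J i _).lineDeriv_eq_fderiv]
    exact (((hG.contDiff_J i).continuous_fderiv one_ne_zero).comp hfst).clm_apply continuous_const
  have hg : ∀ i k, Continuous fun η : ExtSpace d n =>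
      partialD (fun a => inner ℝ η.snd (G.g a)) η.fst i k := fun i k => by
    simp only [partialD, (hG.differentiable_inner_g _ _).lineDeriv_eq_fderiv,
      (hG.hasFDerivAt_inner_g _ _).fderiv, ContinuousLinearMap.comp_apply, innerSL_apply_apply]
    exact hsnd.inner
      (((hG.contDiff_g.continuous_fderiv one_ne_zero).comp hfst).clm_apply continuous_const)
  have hgc : Continuous fun η : ExtSpace d n => G.g η.fst := hG.contDiff_g.continuous.comp hfst
  unfold M0 M
  refine (WithLp.prod_continuous_toLp 2 _ _).comp (Continuous.prodMk ?_ hgc.neg)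
  refine (PiLp.continuous_toLp 2 _).comp (continuous_pi fun i => ?_)
  exact (PiLp.continuous_toLp 2 _).comp (continuous_pi fun k => (hJ i k).add (hg i k))

/-- The multipliers in the box `[0, R]ⁿ`. -/
def dualBox (n : ℕ) (R : ℝ) : Set (ActionSpace n) := {l | ∀ k, l k ∈ Set.Icc 0 R}

theorem IsConvex.exists_mem_SOL_dualBox (hG : G.IsConvex) (hne : G.jointA.Nonempty) {R : ℝ}
    (hR : 0 ≤ R) : ∃ (a : JointSpace d) (l : ActionSpace n),
      (WithLp.toLp 2 (a, l) : ExtSpace d n) ∈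
        SOL {η | η.fst ∈ G.jointA ∧ η.snd ∈ dualBox n R} G.M0 := by
  obtain ⟨b, hb⟩ := hne
  have hbox : IsCompact (dualBox n R) := isCompact_setOf_forall_mem fun _ => isCompact_Icc
  have hcomp : IsCompact {η : ExtSpace d n | η.fst ∈ G.jointA ∧ η.snd ∈ dualBox n R} := by
    convert (hG.isCompact_jointA.prod hbox).image (WithLp.prod_continuous_toLp 2 _ _) using 1
    ext η
    constructor
    · exact fun h => ⟨(η.fst, η.snd), h, rfl⟩
    · rintro ⟨y, hy, rfl⟩
      exact hy
  have hconv : Convex ℝ {η : ExtSpace d n | η.fst ∈ G.jointA ∧ η.snd ∈ dualBox n R} :=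
    fun x hx y hy s t hs ht hst => ⟨hG.convex_jointA hx.1 hy.1 hs ht hst,
      fun k => convex_Icc (0 : ℝ) R (hx.2 k) (hy.2 k) hs ht hst⟩
  have hne : {η : ExtSpace d n | η.fst ∈ G.jointA ∧ η.snd ∈ dualBox n R}.Nonempty :=
    ⟨WithLp.toLp 2 (b, 0), hb, fun _ => Set.left_mem_Icc.2 hR⟩
  obtain ⟨η, hη⟩ := SOL_nonempty hne hcomp hconv hG.continuous_M0
  exact ⟨η.fst, η.snd, hη⟩

theorem IsConvex.exists_isAssocNash (hG : G.IsConvex) (hS : G.Slater) :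
    ∃ (a : JointSpace d) (l : ActionSpace n), G.IsAssocNash a l := by
  obtain ⟨-, -, b, hb, -⟩ := hS.exists_strictly_feasible
  obtain ⟨K, hK, hbound⟩ := hG.exists_norm_le hS
  -- The side `K + 1` exceeds the a priori bound `K`, so no coordinate of `l` reaches the upper
  -- face.
  obtain ⟨a, l, hsol⟩ := hG.exists_mem_SOL_dualBox ⟨b, hb⟩ (R := K + 1) (by positivity)
  obtain ⟨ha, hl, hreg, hdual⟩ := hG.mem_SOL_iff.1 hsol
  have hl0 : l ∈ nonnegOrthant n := fun k => (hl k).1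
  have hnorm : ‖l‖ ≤ K := hbound a l ha hl0 hreg (by
    simpa using hdual 0 fun _ => Set.left_mem_Icc.2 (by positivity))
  refine ⟨a, l, isAssocNash_iff.2 ⟨ha, hl0, (hG.solvesRegularVI_iff_forall_le ha hl0).1 hreg,
    fun m hm => ?_⟩⟩
  have hlt : ∀ k, l k < K + 1 := fun k => by
    have h1 := PiLp.norm_apply_le l k
    have h2 := le_abs_self (l k)
    rw [Real.norm_eq_abs] at h1
    linarith
  have hev : ∀ᶠ t : ℝ in nhdsWithin 0 (Set.Ioi 0), t < 1 ∧ ∀ k, l k + t * (m k - l k) < K + 1 := by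
    refine nhdsWithin_le_nhds ((eventually_lt_nhds one_pos).and (Filter.eventually_all.2 fun k => ?_))
    have hc : Continuous fun t : ℝ => l k + t * (m k - l k) := by fun_prop
    exact hc.continuousAt.eventually_lt_const (by simpa using hlt k)
  obtain ⟨t, ⟨ht1, ht⟩, ht0⟩ := (hev.and self_mem_nhdsWithin).exists
  have ht0' : 0 < t := ht0
  -- A short step from `l` towards any `m ≥ 0` stays in the box; by linearity in the dual action,
  -- optimality along it gives optimality against `m`.
  have h := hdual (l + t • (m - l)) fun k => by
    refine ⟨?_, (ht k).le⟩
    have h1 : (l + t • (m - l)) k = (1 - t) * l k + t * m k := by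
      simp only [PiLp.add_apply, PiLp.smul_apply, PiLp.sub_apply, smul_eq_mul]; ring
    rw [h1]
    exact add_nonneg (mul_nonneg (by linarith) (hl0 k)) (mul_nonneg ht0'.le (hm k))
  rw [inner_add_left, real_inner_smul_left, inner_sub_left] at h
  by_contra! hcon
  linarith [mul_pos ht0' (sub_pos.2 hcon)]

end Game

theorem lemma1 {N n : ℕ} {d : Fin N → ℕ} (G : Game N n d) (hconv : G.IsConvex)
    (hslater : G.Slater) :
    (∀ (a : JointSpace d) (l : ActionSpace n),
      G.IsAssocNash a l ↔ (WithLp.toLp 2 (a, l) : ExtSpace d n) ∈ SOL G.extSet G.M0) ∧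
    (∀ (a : JointSpace d) (l : ActionSpace n), G.IsAssocNash a l → G.IsGNE a) ∧
    (∃ (a : JointSpace d) (l : ActionSpace n), G.IsAssocNash a l) ∧
    (∃ K : ℝ, 0 < K ∧
      ∀ (a : JointSpace d) (l : ActionSpace n), G.IsAssocNash a l → ‖l‖ ≤ K) := by
  refine ⟨fun a l => hconv.isAssocNash_iff_mem_SOL, fun a l h => h.isGNE,
    hconv.exists_isAssocNash hslater, ?_⟩
  obtain ⟨K, hK, hbound⟩ := hconv.exists_norm_le hslater
  refine ⟨K, hK, fun a l h => ?_⟩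
  obtain ⟨ha, hl, hreg, hdual⟩ := Game.isAssocNash_iff.1 h
  exact hbound a l ha hl ((hconv.solvesRegularVI_iff_forall_le ha hl).2 hreg)
    (by simpa using hdual 0 Game.zero_mem_nonnegOrthant)
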